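/- **FTPL via bounded support perturbation.** Consider the stochastic $K$-armed bandit ($K\ge 1$): in round $t=1,\dots,T$ a reward vector $(g_{t,1},\dots,g_{t,K})$ is drawn independently of the past, $g_{t,i}$ having the distribution of arm $i$, whose mean is $\mu_i\in[0,1]$ and which is $1$-sub-Gaussian, i.e. $\mathrm E\,e^{\lambda(g_{t,i}-\mu_i)}\le e^{\lambda^2/2}$ for all $\lambda\in\mathbb R$. The learner pulls an arm $A_t\in\{1,\dots,K\}$ and receives $X_t=g_{t,A_t}$. Put $\Delta_i=\max_j\mu_j-\mu_i$, let $T_i(t)$ be the number of pulls of arm $i$ in the first $t$ rounds, $\hat\mu_i(t)$ the average of the rewards received from arm $i$ in these rounds ($\hat\mu_i(t)=0$ if $T_i(t)=0$), and let $\mathrm R(T)=T\max_i\mu_i-\mathrm E\big[\sum_{t=1}^T X_t\big]$ be the regret. Let $Z$ be a random variable with values in $[-1,1]$ and $\mathrm E[Z]=0$, and let $\epsilon>0$ be such that $$\frac{\mathrm P\big(Z\le\sqrt{2/(2+\epsilon)}\big)}{\mathrm P\big(Z\ge\sqrt{2/(2+\epsilon)}\big)}=M_{Z,\epsilon}\qquad\text{for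 some } 0<M_{Z,\epsilon}<\infty .$$ The Follow-The-Perturbed-Leader (FTPL) algorithm with perturbation $Z$, parameter $\epsilon$ and horizon $T$ pulls in each round $t\le T$ $$A_t\in\arg\max_{1\le i\le K}\;\Big(\hat\mu_i(t-1)+\sqrt{\frac{(2+\epsilon)\log T}{\max(1,T_i(t-1))}}\;Z_{it}\Big),$$ where the $Z_{it}$ are independent copies of $Z$, drawn in round $t$ independently of the past; the rewards of round $t$ are independent of the past and of the choice of $A_t$, and ties are broken arbitrarily subject to this. Then there is a constant $C>0$, which depends only on $\epsilon$ and the law of $Z$ (not on $K$, $T$ or the reward distributions), such that $$\mathrm R(T)\le C\sum_{i:\Delta_i>0}\Big(\frac{\log T}{\Delta_i}+\Delta_i\Big)\ \text{ for all } T\ge 1,\qquad \mathrm R(T)\le C\sqrt{KT\log T}\ \text{ for all } T\ge 2 .$$ In particular, for every $\epsilon>0$ both bounds hold when $Z$ is uniform on $[-1,1]$ and when $Z$ is Rademacher ($Z=\pm1$ with probability $1/2$ each), i.e. for the randomized confidence bound (RCB) algorithms. -/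

import Mathlib

open MeasureTheory ProbabilityTheory
open scoped ENNReal

universe u

noncomputable section

namespace Bandit

variable {K : ℕ} {Ω : Type*}

/-- Mean reward `μ_i` of arm `i`, where `D i` is the reward distribution of arm `i`. -/
def armMean (D : Fin K → Measure ℝ) (i : Fin K) : ℝ := ∫ x, x ∂(D i)

/-- The largest mean reward. -/
def bestMean (D : Fin K → Measure ℝ) : ℝ := ⨆ i, armMean D i

/-- Sub-optimality gap `Δ_i` of arm `i`. -/
def gap (D : Fin K → Measure ℝ) (i : Fin K) : ℝ := bestMean D - armMean D i

/-- `T_i(t)`: the number of pulls of arm `i` in the first `t` rounds. Rounds are numbered from `0`,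
so that the first `t` rounds are those with index `s < t`. -/
def pulls (A : ℕ → Ω → Fin K) (i : Fin K) (t : ℕ) (ω : Ω) : ℕ :=
  ∑ s ∈ Finset.range t, if A s ω = i then 1 else 0

/-- `μ̂_i(t)`: the average reward received from arm `i` in the first `t` rounds. It is `0` as long
as arm `i` has not been pulled (division by zero gives zero). -/
def sampleMean (g : ℕ → Ω → Fin K → ℝ) (A : ℕ → Ω → Fin K) (i : Fin K) (t : ℕ) (ω : Ω) : ℝ :=
  (∑ s ∈ Finset.range t, if A s ω = i then g s ω (A s ω) else 0) / (pulls A i t ω : ℝ)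

/-- The perturbed index `μ̂_i + √((2 + ε) log T / (1 ∨ T_i)) * Z_i` of arm `i`, computed after `t`
rounds of a game with horizon `T` and used to choose the next arm. -/
def ftplIndex (ε : ℝ) (T : ℕ) (g Z : ℕ → Ω → Fin K → ℝ) (A : ℕ → Ω → Fin K)
    (i : Fin K) (t : ℕ) (ω : Ω) : ℝ :=
  sampleMean g A i t ω +
    √((2 + ε) * Real.log T / max 1 (pulls A i t ω : ℝ)) * Z t ω i

/-- What has happened in the first `t` rounds: reward vectors, perturbations and actions. -/
def past (g Z : ℕ → Ω → Fin K → ℝ) (A : ℕ → Ω → Fin K) (t : ℕ) (ω : Ω) :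
    Fin t → (Fin K → ℝ) × (Fin K → ℝ) × Fin K :=
  fun s => (g s ω, Z s ω, A s ω)

/-- `(g, Z, A)` is a run over `T` rounds of Follow-The-Perturbed-Leader with the bounded
perturbation law `ν` and parameter `ε`, in the stochastic bandit with reward distributions `D`.
Here `g t ω i` is the reward that arm `i` offers in round `t`, `Z t ω i` is the perturbation of
arm `i` in round `t`, and `A t ω` is the arm pulled in round `t`, whose reward is `g t ω (A t ω)`.
Ties in the argmax may be broken in any way (also at random) that does not depend on the rewards
of the current round or on rewards and perturbations of later rounds. -/
structure IsFTPLRun [MeasurableSpace Ω] (P : Measure Ω) (D : Fin K → Measure ℝ) (ν : Measure ℝ)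
    (ε : ℝ) (T : ℕ) (g Z : ℕ → Ω → Fin K → ℝ) (A : ℕ → Ω → Fin K) : Prop where
  measurable_reward : ∀ t < T, Measurable (g t)
  measurable_perturbation : ∀ t < T, Measurable (Z t)
  measurable_action : ∀ t < T, Measurable (A t)
  /-- The reward of arm `i` has distribution `D i` in every round. -/
  reward_law : ∀ t < T, ∀ i, P.map (fun ω => g t ω i) = D i
  /-- In every round, the perturbations of the `K` arms are independent with law `ν`. -/
  perturbation_law : ∀ t < T, P.map (Z t) = Measure.pi (fun _ => ν)
  /-- The perturbations of a round are drawn independently of all earlier rounds. -/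
  perturbation_indep : ∀ t < T, IndepFun (Z t) (past g Z A t) P
  /-- The rewards of a round are independent of all earlier rounds and of the choice of the
  action in this round. -/
  reward_indep : ∀ t < T, IndepFun (g t) (fun ω => (past g Z A t ω, Z t ω, A t ω)) P
  /-- The arm pulled maximizes the perturbed index. -/
  action_argmax : ∀ t < T, ∀ᵐ ω ∂P, ∀ j,
    ftplIndex ε T g Z A j t ω ≤ ftplIndex ε T g Z A (A t ω) t ω

/-- The regret `T * max_i μ_i - E[∑_t X_t]` over `T` rounds, where `X_t` is the reward received. -/
def regret [MeasurableSpace Ω] (P : Measure Ω) (D : Fin K → Measure ℝ) (T : ℕ)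
    (g : ℕ → Ω → Fin K → ℝ) (A : ℕ → Ω → Fin K) : ℝ :=
  T * bestMean D - ∫ ω, ∑ t ∈ Finset.range T, g t ω (A t ω) ∂P

/-- Follow-The-Perturbed-Leader with perturbation law `ν` and parameter `ε` has the
instance-dependent regret bound `C * ∑_{Δ_i > 0} (log T / Δ_i + Δ_i)` and the instance-independent
regret bound `C * √(K T log T)` (for `T ≥ 2`), with one constant `C` for all numbers of arms,
all horizons and all bandits with 1-sub-Gaussian rewards and means in `[0, 1]`. -/
def HasFTPLRegretBounds (ν : Measure ℝ) (ε : ℝ) : Prop :=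
  ∃ C : ℝ, 0 < C ∧
    ∀ (K : ℕ), 0 < K →
    ∀ (D : Fin K → Measure ℝ), (∀ i, IsProbabilityMeasure (D i)) →
    (∀ i, HasSubgaussianMGF (fun x => x - armMean D i) 1 (D i)) →
    (∀ i, armMean D i ∈ Set.Icc (0 : ℝ) 1) →
    ∀ (T : ℕ) (Ω : Type u) (_ : MeasurableSpace Ω) (P : Measure Ω), IsProbabilityMeasure P →
    ∀ (g Z : ℕ → Ω → Fin K → ℝ) (A : ℕ → Ω → Fin K), IsFTPLRun P D ν ε T g Z A →
      regret P D T g A ≤ C * ∑ i with 0 < gap D i, (Real.log T / gap D i + gap D i) ∧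
      (2 ≤ T → regret P D T g A ≤ C * √(K * T * Real.log T))

/-- The uniform distribution on `[-1, 1]`. -/
def uniformLaw : Measure ℝ := volume[|Set.Icc (-1 : ℝ) 1]

/-- The Rademacher distribution: `-1` and `1` with probability `1/2` each. -/
def rademacherLaw : Measure ℝ :=
  (2⁻¹ : ℝ≥0∞) • Measure.dirac (-1 : ℝ) + (2⁻¹ : ℝ≥0∞) • Measure.dirac (1 : ℝ)

end Bandit

end

/-!
The regret is the sum over the arms of the gap times the expected number of pulls, so everything
rests on the bound `E T_i ≤ C log T / Δ_i²` for suboptimal arms and `2 ≤ T`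
(`sum_measureReal_pull_le`). Of the perturbation law `ν` it uses only that
perturbations lie in `[-1, 1]` and are at least `c = √(2 / (2 + ε))` with probability `q > 0`, which is what
the finiteness of the ratio in the hypothesis says.

Let `k` be an optimal arm, `Δ` the gap of arm `i` and `τ = μ_k - Δ / 2`. Write `σ_j` for the factor
of the perturbation in the index of arm `j`. A pull of arm `i` falls into one of three cases
(`measureReal_pull_le`).

* The index of arm `i` exceeds `τ`, so `μ̂_i + σ_i > τ`. Once arm `i` has been pulled of the order
  of `log T / Δ²` times, `σ_i ≤ Δ / 4`, and `μ̂_i` has to exceed `μ_i` by `Δ / 4`; by sub-Gaussian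
  concentration the expected number of such pulls is of the order of `1 / Δ²`
  (`sum_pull_deviation_le`).
* `μ̂_k + c σ_k ≤ τ`. As `c σ_k = √(2 log T / T_k)` is the radius of a UCB algorithm, this has
  probability of the order of `1 / (Δ² T)` in every round (`measureReal_ucb_le`).
* The index of arm `i` is at most `τ`, but `μ̂_k + c σ_k > τ`. Given the past and the perturbations
  of the other arms, arm `k` would have won with probability at least `q`. So this case is at most
  `1 / q` times as likely as a pull of arm `k` with `μ̂_k - σ_k ≤ τ` (`measureReal_pull_low_le`),
  and such pulls are counted as in the first case.

Concentration for adaptively sampled rewards comes from the exponential supermartingale stopped after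
the `m`-th pull (`lintegral_exp_stoppedLogMart_le`), and the worst-case bound from the
instance-dependent one by the Cauchy-Schwarz inequality (`sum_mul_le_sqrt`).
-/

namespace Bandit

/-! ### Counting pulls -/

section Counting

variable {K : ℕ} {Ω : Type*} {A : ℕ → Ω → Fin K} {i : Fin K}

theorem pulls_succ (A : ℕ → Ω → Fin K) (i : Fin K) (t : ℕ) (ω : Ω) :
    pulls A i (t + 1) ω = pulls A i t ω + if A t ω = i then 1 else 0 := by
  rw [pulls, Finset.sum_range_succ, ← pulls]

theorem pulls_mono (A : ℕ → Ω → Fin K) (i : Fin K) (ω : Ω) : Monotone fun t => pulls A i t ω :=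
  monotone_nat_of_le_succ fun t => by rw [pulls_succ]; exact Nat.le_add_right _ _

theorem pulls_lt_pulls {s t : ℕ} {ω : Ω} (hst : s < t) (hs : A s ω = i) :
    pulls A i s ω < pulls A i t ω := by
  have h : pulls A i (s + 1) ω ≤ pulls A i t ω := pulls_mono A i ω hst
  rw [pulls_succ, if_pos hs] at h
  omega

theorem pulls_le (A : ℕ → Ω → Fin K) (i : Fin K) (t : ℕ) (ω : Ω) : pulls A i t ω ≤ t := by
  calc pulls A i t ω ≤ ∑ s ∈ Finset.range t, 1 :=
        Finset.sum_le_sum fun s _ => by split_ifs <;> simp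
    _ = t := by simp

theorem measurable_pulls [MeasurableSpace Ω] {t : ℕ} (hA : ∀ s < t, Measurable (A s)) :
    Measurable (pulls A i t) := by
  unfold pulls
  refine Finset.measurable_sum _ fun s hs => ?_
  exact Measurable.ite (hA s (Finset.mem_range.1 hs) (measurableSet_singleton i))
    measurable_const measurable_const

theorem measurable_reward_ite [MeasurableSpace Ω] {g : Ω → Fin K → ℝ} {B : Ω → Fin K}
    (hg : Measurable g) (hB : Measurable B) :
    Measurable fun ω => if B ω = i then g ω (B ω) else 0 := by
  have : (fun ω => if B ω = i then g ω (B ω) else 0) = fun ω => if B ω = i then g ω i else 0 := by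
    funext ω
    split_ifs with h
    · rw [h]
    · rfl
  rw [this]
  exact Measurable.ite (hB (measurableSet_singleton i)) ((measurable_pi_apply i).comp hg)
    measurable_const

theorem measurable_sampleMean [MeasurableSpace Ω] {g : ℕ → Ω → Fin K → ℝ} {t : ℕ}
    (hg : ∀ s < t, Measurable (g s)) (hA : ∀ s < t, Measurable (A s)) :
    Measurable (sampleMean g A i t) := by
  unfold sampleMean
  refine Measurable.div ?_ (measurable_from_nat.comp (measurable_pulls hA))
  refine Finset.measurable_sum _ fun s hs => ?_
  exact measurable_reward_ite (hg s (Finset.mem_range.1 hs)) (hA s (Finset.mem_range.1 hs))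

/-- The sum of the empirical deviations of arm `i`: multiplying out the sample mean needs no
case distinction, since both sides vanish as long as the arm has not been pulled. -/
theorem sum_sub_eq (g : ℕ → Ω → Fin K → ℝ) (A : ℕ → Ω → Fin K) (i : Fin K) (μ : ℝ) (t : ℕ)
    (ω : Ω) :
    (∑ s ∈ Finset.range t, if A s ω = i then g s ω i - μ else 0) =
      pulls A i t ω * (sampleMean g A i t ω - μ) := by
  have h1 : (∑ s ∈ Finset.range t, if A s ω = i then g s ω i - μ else 0) =
      (∑ s ∈ Finset.range t, if A s ω = i then g s ω (A s ω) else 0) - pulls A i t ω * μ := by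
    rw [pulls, Nat.cast_sum, Finset.sum_mul, ← Finset.sum_sub_distrib]
    refine Finset.sum_congr rfl fun s _ => ?_
    split_ifs with h
    · rw [h]; simp
    · simp
  rw [h1, mul_sub]
  congr 1
  rcases Nat.eq_zero_or_pos (pulls A i t ω) with h0 | h0
  · rw [h0, Nat.cast_zero, zero_mul]
    refine Finset.sum_eq_zero fun s hs => if_neg fun h => ?_
    have := pulls_lt_pulls (Finset.mem_range.1 hs) h
    omega
  · rw [sampleMean, mul_div_cancel₀]
    positivity

/-- Counting the pulls of arm `i` in a run by the number of earlier pulls of that arm: the value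
`m` of this number is attained in at most one round in which the arm is pulled. -/
theorem sum_pull_inter_le [MeasurableSpace Ω] {P : Measure Ω} [IsProbabilityMeasure P] {T : ℕ}
    (hA : ∀ t < T, Measurable (A t)) {B : ℕ → Set Ω} (hB : ∀ t < T, MeasurableSet (B t)) :
    ∑ t ∈ Finset.range T, P.real ({ω | A t ω = i} ∩ B t) ≤
      ∑ m ∈ Finset.range T, P.real {ω | ∃ t < T, pulls A i t ω = m ∧ ω ∈ B t} := by
  have hmeas : ∀ m, ∀ t ∈ Finset.range T,
      MeasurableSet {ω | A t ω = i ∧ pulls A i t ω = m ∧ ω ∈ B t} := fun m t ht => by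
    have ht := Finset.mem_range.1 ht
    refine (hA t ht (measurableSet_singleton i)).inter (MeasurableSet.inter ?_ (hB t ht))
    exact measurable_pulls (fun s hs => hA s (hs.trans ht)) (measurableSet_singleton m)
  calc ∑ t ∈ Finset.range T, P.real ({ω | A t ω = i} ∩ B t)
      ≤ ∑ t ∈ Finset.range T, ∑ m ∈ Finset.range T,
          P.real {ω | A t ω = i ∧ pulls A i t ω = m ∧ ω ∈ B t} := by
        refine Finset.sum_le_sum fun t ht => ?_
        refine le_trans (measureReal_mono ?_ (measure_ne_top _ _))
          (measureReal_biUnion_finset_le (Finset.range T) _)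
        rintro ω ⟨h1, h2⟩
        simp only [Set.mem_iUnion]
        exact ⟨pulls A i t ω, Finset.mem_range.2
          ((pulls_le A i t ω).trans_lt (Finset.mem_range.1 ht)), h1, rfl, h2⟩
    _ = ∑ m ∈ Finset.range T, ∑ t ∈ Finset.range T,
          P.real {ω | A t ω = i ∧ pulls A i t ω = m ∧ ω ∈ B t} := Finset.sum_comm
    _ ≤ _ := by
        refine Finset.sum_le_sum fun m _ => ?_
        rw [← measureReal_biUnion_finset _ (hmeas m)]
        · refine measureReal_mono ?_ (measure_ne_top _ _)
          intro ω hω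
          simp only [Set.mem_iUnion] at hω
          obtain ⟨t, ht, -, h2, h3⟩ := hω
          exact ⟨t, Finset.mem_range.1 ht, h2, h3⟩
        · intro s _ t _ hst
          refine Set.disjoint_left.2 ?_
          rintro ω ⟨h1, h2, -⟩ ⟨h1', h2', -⟩
          rcases lt_or_gt_of_ne hst with h | h
          · have := pulls_lt_pulls h h1; omega
          · have := pulls_lt_pulls h h1'; omega

end Counting

/-! ### Concentration of the sample means -/

section Concentration

variable {K : ℕ} {Ω : Type*}

/-- The logarithm of the exponential supermartingale of arm `i` with parameter `θ` and centre `μ`,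
stopped after the `m`-th pull of the arm. -/
noncomputable def stoppedLogMart (g : ℕ → Ω → Fin K → ℝ) (A : ℕ → Ω → Fin K) (i : Fin K)
    (μ θ : ℝ) (m t : ℕ) (ω : Ω) : ℝ :=
  ∑ s ∈ Finset.range t,
    if A s ω = i ∧ pulls A i s ω < m then θ * (g s ω i - μ) - θ ^ 2 / 2 else 0

theorem measurableSet_pull_lt [MeasurableSpace Ω] {A : ℕ → Ω → Fin K} {t : ℕ}
    (hA : ∀ s ≤ t, Measurable (A s)) (i : Fin K) (m : ℕ) :
    MeasurableSet {ω | A t ω = i ∧ pulls A i t ω < m} :=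
  (hA t le_rfl (measurableSet_singleton i)).inter
    (measurable_pulls (fun s hs => hA s hs.le) measurableSet_Iio)

theorem measurable_stoppedLogMart [MeasurableSpace Ω] {g : ℕ → Ω → Fin K → ℝ}
    {A : ℕ → Ω → Fin K} {t : ℕ} (hg : ∀ s < t, Measurable (g s)) (hA : ∀ s < t, Measurable (A s))
    (i : Fin K) (μ θ : ℝ) (m : ℕ) : Measurable (stoppedLogMart g A i μ θ m t) := by
  unfold stoppedLogMart
  refine Finset.measurable_sum _ fun s hs => ?_
  have hs := Finset.mem_range.1 hs
  refine Measurable.ite (measurableSet_pull_lt (fun r hr => hA r (hr.trans_lt hs)) i m) ?_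
    measurable_const
  exact (((measurable_pi_apply i).comp (hg s hs)).sub_const _).const_mul _ |>.sub_const _

theorem stoppedLogMart_eq {g : ℕ → Ω → Fin K → ℝ} {A : ℕ → Ω → Fin K} {i : Fin K} {μ θ : ℝ}
    {m t T : ℕ} {ω : Ω} (ht : t ≤ T) (hm : pulls A i t ω = m) :
    stoppedLogMart g A i μ θ m T ω =
      θ * (m * (sampleMean g A i t ω - μ)) - m * (θ ^ 2 / 2) := by
  have h1 : stoppedLogMart g A i μ θ m T ω =
      ∑ s ∈ Finset.range t, if A s ω = i then θ * (g s ω i - μ) - θ ^ 2 / 2 else 0 := by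
    unfold stoppedLogMart
    rw [← Finset.sum_subset (Finset.range_mono ht)]
    · refine Finset.sum_congr rfl fun s hs => ?_
      by_cases h : A s ω = i
      · have := pulls_lt_pulls (Finset.mem_range.1 hs) h
        rw [if_pos ⟨h, by omega⟩, if_pos h]
      · rw [if_neg (fun h' => h h'.1), if_neg h]
    · intro s _ hs
      have h2 : pulls A i t ω ≤ pulls A i s ω :=
        pulls_mono A i ω (by simpa using hs)
      exact if_neg fun h => by omega
  have h2 : (m : ℝ) = ∑ s ∈ Finset.range t, if A s ω = i then (1 : ℝ) else 0 := by
    rw [← hm, pulls]; push_cast; rfl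
  have h3 := sum_sub_eq g A i μ t ω
  rw [hm] at h3
  rw [h1, ← h3, h2, Finset.mul_sum, Finset.sum_mul, ← Finset.sum_sub_distrib]
  refine Finset.sum_congr rfl fun s _ => ?_
  split_ifs <;> ring

theorem measurable_comap_past (g Z : ℕ → Ω → Fin K → ℝ) (A : ℕ → Ω → Fin K) {s t : ℕ}
    (hs : s < t) :
    Measurable[MeasurableSpace.comap (past g Z A t) inferInstance] (g s) ∧
      Measurable[MeasurableSpace.comap (past g Z A t) inferInstance] (A s) := by
  have h : Measurable[MeasurableSpace.comap (past g Z A t) inferInstance] (past g Z A t) :=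
    comap_measurable _
  have h' := (measurable_pi_apply (⟨s, hs⟩ : Fin t)).comp h
  exact ⟨measurable_fst.comp h', (measurable_snd.comp measurable_snd).comp h'⟩

/-- The information that precedes the rewards of round `t`: the earlier rounds together with the
perturbations and the action of round `t`. -/
@[reducible] def infoBeforeReward (g Z : ℕ → Ω → Fin K → ℝ) (A : ℕ → Ω → Fin K) (t : ℕ) :
    MeasurableSpace Ω :=
  MeasurableSpace.comap (fun ω => (past g Z A t ω, Z t ω, A t ω)) inferInstance

theorem measurable_infoBeforeReward (g Z : ℕ → Ω → Fin K → ℝ) (A : ℕ → Ω → Fin K) (t : ℕ) :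
    (∀ s < t, Measurable[infoBeforeReward g Z A t] (g s)) ∧
      ∀ s ≤ t, Measurable[infoBeforeReward g Z A t] (A s) := by
  have h : Measurable[infoBeforeReward g Z A t] (fun ω => (past g Z A t ω, Z t ω, A t ω)) :=
    comap_measurable _
  refine ⟨fun s hs => ?_, fun s hs => ?_⟩
  · exact measurable_fst.comp ((measurable_pi_apply (⟨s, hs⟩ : Fin t)).comp (measurable_fst.comp h))
  · rcases hs.lt_or_eq with hs | rfl
    · exact (measurable_snd.comp measurable_snd).comp
        ((measurable_pi_apply (⟨s, hs⟩ : Fin t)).comp (measurable_fst.comp h))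
    · exact (measurable_snd.comp measurable_snd).comp h

/-- Multiplying a nonnegative variable on part of the space by an independent factor of mean at
most `1` does not increase its expectation. -/
theorem lintegral_indicator_mul_le {F G mΩ : MeasurableSpace Ω} {P : Measure Ω} (hF : F ≤ mΩ)
    (hG : G ≤ mΩ) (hind : Indep G F P) {S : Set Ω} {W Y : Ω → ℝ≥0∞} (hS : MeasurableSet[F] S)
    (hW : Measurable[F] W) (hY : Measurable[G] Y) (hY1 : ∫⁻ ω, Y ω ∂P ≤ 1) :
    ∫⁻ ω, (Sᶜ.indicator W ω + Y ω * S.indicator W ω) ∂P ≤ ∫⁻ ω, W ω ∂P := by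
  rw [lintegral_add_left ((hW.mono hF le_rfl).indicator (hF _ hS).compl),
    lintegral_mul_eq_lintegral_mul_lintegral_of_independent_measurableSpace
      hG hF hind hY (hW.indicator hS)]
  calc _ ≤ ∫⁻ ω, Sᶜ.indicator W ω ∂P + 1 * ∫⁻ ω, S.indicator W ω ∂P := by gcongr
    _ = ∫⁻ ω, W ω ∂P := by
        rw [one_mul, lintegral_indicator (hF _ hS).compl, lintegral_indicator (hF _ hS), add_comm,
          lintegral_add_compl _ (hF _ hS)]

variable [MeasurableSpace Ω] {P : Measure Ω} {D : Fin K → Measure ℝ} {ν : Measure ℝ} {ε : ℝ}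
  {T : ℕ} {g Z : ℕ → Ω → Fin K → ℝ} {A : ℕ → Ω → Fin K}

theorem IsFTPLRun.measurable_past (hrun : IsFTPLRun P D ν ε T g Z A) {t : ℕ} (ht : t ≤ T) :
    Measurable (past g Z A t) := by
  refine measurable_pi_lambda _ fun s => ?_
  have hs := s.2.trans_le ht
  exact (hrun.measurable_reward s hs).prodMk
    ((hrun.measurable_perturbation s hs).prodMk (hrun.measurable_action s hs))

theorem lintegral_exp_reward_le [IsProbabilityMeasure P] (hrun : IsFTPLRun P D ν ε T g Z A)
    {i : Fin K} (hsub : HasSubgaussianMGF (fun x => x - armMean D i) 1 (D i)) {t : ℕ} (ht : t < T)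
    (θ : ℝ) :
    ∫⁻ ω, ENNReal.ofReal (Real.exp (θ * (g t ω i - armMean D i) - θ ^ 2 / 2)) ∂P ≤ 1 := by
  have hmeas : Measurable fun ω => g t ω i :=
    (measurable_pi_apply i).comp (hrun.measurable_reward t ht)
  have h1 : ∫⁻ ω, ENNReal.ofReal (Real.exp (θ * (g t ω i - armMean D i) - θ ^ 2 / 2)) ∂P =
      ∫⁻ x, ENNReal.ofReal (Real.exp (θ * (x - armMean D i) - θ ^ 2 / 2)) ∂(D i) := by
    rw [← hrun.reward_law t ht i, lintegral_map (by fun_prop) hmeas]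
  have h2 : ∀ x, Real.exp (θ * (x - armMean D i) - θ ^ 2 / 2) =
      Real.exp (θ * (x - armMean D i)) * Real.exp (-(θ ^ 2 / 2)) := fun x => by
    rw [← Real.exp_add, sub_eq_add_neg]
  rw [h1]
  simp_rw [h2]
  rw [← ofReal_integral_eq_lintegral_ofReal ((hsub.integrable_exp_mul θ).mul_const _)
    (Filter.Eventually.of_forall fun x => by positivity), integral_mul_const]
  refine ENNReal.ofReal_le_one.2 ?_
  have h3 : ∫ x, Real.exp (θ * (x - armMean D i)) ∂(D i) ≤ Real.exp (θ ^ 2 / 2) := by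
    simpa [mgf] using hsub.mgf_le θ
  calc _ ≤ Real.exp (θ ^ 2 / 2) * Real.exp (-(θ ^ 2 / 2)) := by gcongr
    _ = 1 := by rw [← Real.exp_add]; simp

theorem lintegral_exp_stoppedLogMart_le [IsProbabilityMeasure P]
    (hrun : IsFTPLRun P D ν ε T g Z A) {i : Fin K}
    (hsub : HasSubgaussianMGF (fun x => x - armMean D i) 1 (D i)) (θ : ℝ) (m : ℕ) {t : ℕ}
    (ht : t ≤ T) :
    ∫⁻ ω, ENNReal.ofReal (Real.exp (stoppedLogMart g A i (armMean D i) θ m t ω)) ∂P ≤ 1 := by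
  induction t with
  | zero => simp [stoppedLogMart]
  | succ t ih =>
    have ht' : t < T := ht
    obtain ⟨hFg, hFA⟩ := measurable_infoBeforeReward g Z A t
    set S : Set Ω := {ω | A t ω = i ∧ pulls A i t ω < m} with hS
    set W : Ω → ℝ≥0∞ := fun ω =>
      ENNReal.ofReal (Real.exp (stoppedLogMart g A i (armMean D i) θ m t ω)) with hW
    have hSF : MeasurableSet[infoBeforeReward g Z A t] S :=
      @measurableSet_pull_lt K Ω (infoBeforeReward g Z A t) A t hFA i m
    have hWF : Measurable[infoBeforeReward g Z A t] W :=
      ENNReal.measurable_ofReal.comp (Real.measurable_exp.comp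
        (@measurable_stoppedLogMart K Ω (infoBeforeReward g Z A t) g A t hFg
          (fun s hs => hFA s hs.le) i _ θ m))
    have hY : Measurable fun v : Fin K → ℝ =>
        ENNReal.ofReal (Real.exp (θ * (v i - armMean D i) - θ ^ 2 / 2)) := by fun_prop
    have hsplit : ∀ ω, ENNReal.ofReal
        (Real.exp (stoppedLogMart g A i (armMean D i) θ m (t + 1) ω)) =
          Sᶜ.indicator W ω +
            ENNReal.ofReal (Real.exp (θ * (g t ω i - armMean D i) - θ ^ 2 / 2)) *
              S.indicator W ω := fun ω => by
      rw [stoppedLogMart, Finset.sum_range_succ, ← stoppedLogMart]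
      by_cases h : ω ∈ S
      · have h' : A t ω = i ∧ pulls A i t ω < m := h
        rw [if_pos h', Set.indicator_of_notMem (by simpa using h), Set.indicator_of_mem h, zero_add,
          Real.exp_add, ENNReal.ofReal_mul (Real.exp_pos _).le, mul_comm]
      · have h' : ¬ (A t ω = i ∧ pulls A i t ω < m) := h
        rw [if_neg h', Set.indicator_of_mem (by simpa using h), Set.indicator_of_notMem h, mul_zero]
        simp [hW]
    simp_rw [hsplit]
    refine le_trans (lintegral_indicator_mul_le ?_ (hrun.measurable_reward t ht').comap_le
      (hrun.reward_indep t ht') hSF hWF (hY.comp (comap_measurable (g t)))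
      (lintegral_exp_reward_le hrun hsub ht' θ)) (ih ht'.le)
    exact ((hrun.measurable_past ht'.le).prodMk
      ((hrun.measurable_perturbation t ht').prodMk (hrun.measurable_action t ht'))).comap_le

/-- Sub-Gaussian concentration for adaptively sampled rewards: the sample mean of the first `m`
rewards of arm `i` deviates by `θ` (upwards if `0 < θ`, downwards if `θ < 0`) with probability at
most `exp (-m θ² / 2)`. -/
theorem measureReal_deviation_le [IsProbabilityMeasure P] (hrun : IsFTPLRun P D ν ε T g Z A)
    {i : Fin K} (hsub : HasSubgaussianMGF (fun x => x - armMean D i) 1 (D i)) (θ : ℝ) (m : ℕ) :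
    P.real {ω | ∃ t < T, pulls A i t ω = m ∧
      θ ^ 2 ≤ θ * (sampleMean g A i t ω - armMean D i)} ≤ Real.exp (-(m * (θ ^ 2 / 2))) := by
  set W : Ω → ℝ≥0∞ := fun ω =>
    ENNReal.ofReal (Real.exp (stoppedLogMart g A i (armMean D i) θ m T ω)) with hW
  have hWm : Measurable W := ENNReal.measurable_ofReal.comp (Real.measurable_exp.comp
    (measurable_stoppedLogMart hrun.measurable_reward hrun.measurable_action i _ θ m))
  set c := ENNReal.ofReal (Real.exp (m * (θ ^ 2 / 2))) with hc
  have h1 : {ω | ∃ t < T, pulls A i t ω = m ∧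
      θ ^ 2 ≤ θ * (sampleMean g A i t ω - armMean D i)} ⊆ {ω | c ≤ W ω} := by
    rintro ω ⟨t, ht, hm, hdev⟩
    refine ENNReal.ofReal_le_ofReal (Real.exp_le_exp.2 ?_)
    rw [stoppedLogMart_eq ht.le hm]
    have := mul_le_mul_of_nonneg_left hdev (Nat.cast_nonneg (α := ℝ) m)
    linarith
  have h2 : P {ω | c ≤ W ω} ≤ 1 / c :=
    (meas_ge_le_lintegral_div hWm.aemeasurable (by simp [hc, Real.exp_pos]) (by simp [hc])).trans
      (ENNReal.div_le_div_right (lintegral_exp_stoppedLogMart_le hrun hsub θ m le_rfl) _)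
  rw [Real.exp_neg]
  refine ENNReal.toReal_le_of_le_ofReal (by positivity) ((measure_mono h1).trans (h2.trans ?_))
  rw [hc, ENNReal.ofReal_inv_of_pos (Real.exp_pos _), one_div]

theorem sum_exp_neg_mul_le {x : ℝ} (hx : 0 < x) (N : ℕ) :
    ∑ m ∈ Finset.range N, Real.exp (-(m * x)) ≤ 1 + 1 / x := by
  have h1 : ∀ m : ℕ, Real.exp (-(m * x)) = (Real.exp (-x)) ^ m := fun m => by
    rw [← Real.exp_nat_mul]; ring_nf
  have h2 : Real.exp (-x) ≤ 1 / (1 + x) := by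
    rw [Real.exp_neg, ← one_div]
    exact one_div_le_one_div_of_le (by linarith) (by linarith [Real.add_one_le_exp x])
  have h3 : Real.exp (-x) < 1 := Real.exp_lt_one_iff.2 (by linarith)
  simp_rw [h1]
  calc _ ≤ (1 - Real.exp (-x))⁻¹ := by
        rw [← one_div, le_div_iff₀ (by linarith), geom_sum_mul_neg]
        linarith [pow_pos (Real.exp_pos (-x)) N]
    _ ≤ (x / (1 + x))⁻¹ := by
        refine inv_anti₀ (by positivity) ?_
        have : x / (1 + x) = 1 - 1 / (1 + x) := by field_simp; ring
        linarith
    _ = 1 + 1 / x := by field_simp; ring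

/-- The expected number of pulls of arm `i` made while its sample mean rests on fewer than `r`
rewards or deviates by `θ` from the mean of the arm. -/
theorem sum_pull_deviation_le [IsProbabilityMeasure P] (hrun : IsFTPLRun P D ν ε T g Z A)
    {i : Fin K} (hsub : HasSubgaussianMGF (fun x => x - armMean D i) 1 (D i)) {θ r : ℝ}
    (hθ : θ ≠ 0) (hr : 0 ≤ r) :
    ∑ t ∈ Finset.range T, P.real ({ω | A t ω = i} ∩ {ω | (pulls A i t ω : ℝ) < r ∨
      θ ^ 2 ≤ θ * (sampleMean g A i t ω - armMean D i)}) ≤ r + 2 + 2 / θ ^ 2 := by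
  have hθ2 : 0 < θ ^ 2 / 2 := by positivity
  refine (sum_pull_inter_le hrun.measurable_action fun t ht => ?_).trans ?_
  · have hA : ∀ s < t, Measurable (A s) := fun s hs => hrun.measurable_action s (hs.trans ht)
    have hg : ∀ s < t, Measurable (g s) := fun s hs => hrun.measurable_reward s (hs.trans ht)
    have h1 : MeasurableSet {ω | (pulls A i t ω : ℝ) < r} :=
      measurableSet_lt (measurable_from_nat.comp (measurable_pulls hA)) measurable_const
    have h2 : MeasurableSet {ω | θ ^ 2 ≤ θ * (sampleMean g A i t ω - armMean D i)} :=
      measurableSet_le measurable_const (((measurable_sampleMean hg hA).sub_const _).const_mul _)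
    exact h1.union h2
  calc ∑ m ∈ Finset.range T, P.real {ω | ∃ t < T, pulls A i t ω = m ∧
          ((pulls A i t ω : ℝ) < r ∨ θ ^ 2 ≤ θ * (sampleMean g A i t ω - armMean D i))}
      ≤ ∑ m ∈ Finset.range T,
        ((if (m : ℝ) < r then 1 else 0) + Real.exp (-(m * (θ ^ 2 / 2)))) := by
        refine Finset.sum_le_sum fun m _ => ?_
        split_ifs with hm
        · exact measureReal_le_one.trans (by linarith [Real.exp_pos (-(m * (θ ^ 2 / 2)))])
        · rw [zero_add]
          refine le_trans (measureReal_mono ?_ (measure_ne_top _ _))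
            (measureReal_deviation_le hrun hsub θ m)
          rintro ω ⟨t, ht, h1, h2⟩
          refine ⟨t, ht, h1, h2.resolve_left ?_⟩
          rwa [h1]
    _ ≤ (r + 1) + (1 + 1 / (θ ^ 2 / 2)) := by
        rw [Finset.sum_add_distrib]
        refine add_le_add (α := ℝ) ?_ (sum_exp_neg_mul_le hθ2 T)
        rw [← Finset.sum_filter, Finset.sum_const, nsmul_eq_mul, mul_one]
        have hsubset : (Finset.range T).filter (fun m : ℕ => (m : ℝ) < r) ⊆
            Finset.range ⌈r⌉₊ := fun m hm => by
          simpa [Nat.lt_ceil] using (Finset.mem_filter.1 hm).2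
        have hcard := Finset.card_le_card hsubset
        rw [Finset.card_range] at hcard
        exact (Nat.cast_le.2 hcard).trans (Nat.ceil_lt_add_one hr).le
    _ = r + 2 + 2 / θ ^ 2 := by rw [one_div_div]; ring

end Concentration

/-! ### A single round -/

section Round

variable {K : ℕ} {Ω : Type*}

/-- The factor of the perturbation in the index of arm `i`. -/
noncomputable def width (ε : ℝ) (T : ℕ) (A : ℕ → Ω → Fin K) (i : Fin K) (t : ℕ) (ω : Ω) : ℝ :=
  √((2 + ε) * Real.log T / max 1 (pulls A i t ω : ℝ))

theorem ftplIndex_eq (ε : ℝ) (T : ℕ) (g Z : ℕ → Ω → Fin K → ℝ) (A : ℕ → Ω → Fin K) (i : Fin K)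
    (t : ℕ) (ω : Ω) :
    ftplIndex ε T g Z A i t ω = sampleMean g A i t ω + width ε T A i t ω * Z t ω i := rfl

theorem width_nonneg (ε : ℝ) (T : ℕ) (A : ℕ → Ω → Fin K) (i : Fin K) (t : ℕ) (ω : Ω) :
    0 ≤ width ε T A i t ω := Real.sqrt_nonneg _

theorem measurable_width [MeasurableSpace Ω] {A : ℕ → Ω → Fin K} {t : ℕ}
    (hA : ∀ s < t, Measurable (A s)) (ε : ℝ) (T : ℕ) (i : Fin K) :
    Measurable (width ε T A i t) := by
  unfold width
  exact ((measurable_const.div (measurable_const.max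
    (measurable_from_nat.comp (measurable_pulls hA)))).sqrt)

theorem measurable_sampleMean_width [MeasurableSpace Ω] {g : ℕ → Ω → Fin K → ℝ}
    {A : ℕ → Ω → Fin K} {t : ℕ} (hg : ∀ s < t, Measurable (g s)) (hA : ∀ s < t, Measurable (A s))
    (ε : ℝ) (T : ℕ) : Measurable fun ω j => (sampleMean g A j t ω, width ε T A j t ω) :=
  measurable_pi_lambda _ fun j => (measurable_sampleMean hg hA).prodMk (measurable_width hA ε T j)

theorem width_le {ε : ℝ} {T : ℕ} {A : ℕ → Ω → Fin K} {i : Fin K} {t : ℕ} {ω : Ω} {δ : ℝ}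
    (hδ : 0 < δ) (h : (2 + ε) * Real.log T / δ ^ 2 ≤ pulls A i t ω) :
    width ε T A i t ω ≤ δ := by
  refine Real.sqrt_le_iff.2 ⟨hδ.le, ?_⟩
  rw [div_le_iff₀ (by positivity)] at h ⊢
  have := le_max_right 1 (pulls A i t ω : ℝ)
  nlinarith [sq_nonneg δ]

/-- If `Z` is a vector of independent variables of law `ν` and `X` is independent of `Z`, then
given `X` and the event that the coordinates of `Z` other than `k` lie in sets determined by `X`,
coordinate `k` still has law `ν`. -/
theorem measure_box_inter {E : Type*} [MeasurableSpace E] [MeasurableSpace Ω] {P : Measure Ω}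
    [IsProbabilityMeasure P] {ν : Measure ℝ} [IsProbabilityMeasure ν] {X : Ω → E}
    {Z : Ω → Fin K → ℝ} (hX : Measurable X) (hZ : Measurable Z)
    (hlaw : P.map Z = Measure.pi fun _ => ν) (hind : IndepFun Z X P) (k : Fin K) {H : Set E}
    (hH : MeasurableSet H) {C : E → Fin K → Set ℝ}
    (hC : ∀ j, MeasurableSet {p : E × (Fin K → ℝ) | p.2 j ∈ C p.1 j}) {B : Set ℝ}
    (hB : MeasurableSet B) :
    P {ω | X ω ∈ H ∧ (∀ j, j ≠ k → Z ω j ∈ C (X ω) j) ∧ Z ω k ∈ B} =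
      ν B * P {ω | X ω ∈ H ∧ ∀ j, j ≠ k → Z ω j ∈ C (X ω) j} := by
  have key : ∀ B' : Set ℝ, MeasurableSet B' →
      P {ω | X ω ∈ H ∧ (∀ j, j ≠ k → Z ω j ∈ C (X ω) j) ∧ Z ω k ∈ B'} =
        ν B' * ∫⁻ x, H.indicator (fun x => ∏ j ∈ Finset.univ.erase k, ν (C x j)) x ∂(P.map X) := by
    intro B' hB'
    have hmap : P.map (fun ω => (X ω, Z ω)) = (P.map X).prod (Measure.pi fun _ => ν) := by
      rw [← hlaw]
      exact (indepFun_iff_map_prod_eq_prod_map_map hX.aemeasurable hZ.aemeasurable).1 hind.symm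
    set S : Set (E × (Fin K → ℝ)) :=
      {p | p.1 ∈ H ∧ (∀ j, j ≠ k → p.2 j ∈ C p.1 j) ∧ p.2 k ∈ B'} with hS
    have hSm : MeasurableSet S := by
      refine (measurable_fst hH).inter (MeasurableSet.inter ?_ ?_)
      · have : {p : E × (Fin K → ℝ) | ∀ j, j ≠ k → p.2 j ∈ C p.1 j} =
            ⋂ j, ⋂ _ : j ≠ k, {p | p.2 j ∈ C p.1 j} := by ext p; simp
        change MeasurableSet {p : E × (Fin K → ℝ) | ∀ j, j ≠ k → p.2 j ∈ C p.1 j}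
        rw [this]
        exact MeasurableSet.iInter fun j => MeasurableSet.iInter fun _ => hC j
      · exact ((measurable_pi_apply k).comp measurable_snd) hB'
    have h1 : P {ω | X ω ∈ H ∧ (∀ j, j ≠ k → Z ω j ∈ C (X ω) j) ∧ Z ω k ∈ B'} =
        P.map (fun ω => (X ω, Z ω)) S := (Measure.map_apply (hX.prodMk hZ) hSm).symm
    have : IsProbabilityMeasure (P.map X) := Measure.isProbabilityMeasure_map hX.aemeasurable
    rw [h1, hmap, Measure.prod_apply hSm, ← lintegral_const_mul' _ _ (measure_ne_top _ _)]
    refine lintegral_congr fun x => ?_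
    by_cases hx : x ∈ H
    · have hbox : Prod.mk x ⁻¹' S =
          Set.univ.pi fun j => if j = k then B' else C x j := by
        ext z
        simp only [hS, Set.mem_preimage, Set.mem_ofPred_eq, hx, true_and, Set.mem_pi, Set.mem_univ,
          true_implies]
        constructor
        · rintro ⟨h1, h2⟩ j
          split_ifs with hj
          · rwa [hj]
          · exact h1 j hj
        · intro h
          refine ⟨fun j hj => ?_, ?_⟩
          · simpa [hj] using h j
          · simpa using h k
      rw [hbox, Measure.pi_pi, Set.indicator_of_mem hx,
        ← Finset.mul_prod_erase _ _ (Finset.mem_univ k), if_pos rfl]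
      congr 1
      refine Finset.prod_congr rfl fun j hj => ?_
      rw [if_neg (Finset.ne_of_mem_erase hj)]
    · rw [Set.indicator_of_notMem hx, mul_zero]
      have : Prod.mk x ⁻¹' S = ∅ := by ext z; simp [hS, hx]
      rw [this, measure_empty]
  have h2 := key Set.univ MeasurableSet.univ
  simp only [Set.mem_univ, and_true, measure_univ, one_mul] at h2
  rw [key B hB, h2]

variable [MeasurableSpace Ω] {P : Measure Ω} {D : Fin K → Measure ℝ} {ν : Measure ℝ} {ε : ℝ}
  {T : ℕ} {g Z : ℕ → Ω → Fin K → ℝ} {A : ℕ → Ω → Fin K}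

theorem IsFTPLRun.ae_perturbation_mem [IsProbabilityMeasure ν] (hrun : IsFTPLRun P D ν ε T g Z A)
    (hν : ∀ᵐ z ∂ν, z ∈ Set.Icc (-1 : ℝ) 1) {t : ℕ} (ht : t < T) :
    ∀ᵐ ω ∂P, ∀ j, Z t ω j ∈ Set.Icc (-1 : ℝ) 1 := by
  refine ae_all_iff.2 fun j => ?_
  have h1 : Measurable fun ω => Z t ω j :=
    (measurable_pi_apply j).comp (hrun.measurable_perturbation t ht)
  have h2 : P.map (fun ω => Z t ω j) = ν := by
    have := Measure.map_map (μ := P) (measurable_pi_apply (X := fun _ : Fin K => ℝ) j)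
      (hrun.measurable_perturbation t ht)
    rw [hrun.perturbation_law t ht, (measurePreserving_eval (fun _ : Fin K => ν) j).map_eq] at this
    exact this.symm
  rw [← h2] at hν
  exact ae_of_ae_map h1.aemeasurable hν

/-- Suppose that the index of arm `k` exceeds `τ` as soon as its perturbation is at least `c`. If
the arm pulled has an index of at most `τ`, then so have all arms other than `k`. Given this and the
past, the perturbation of arm `k` still has law `ν`, so it is at least `c` with probability
`q = ν [c, ∞)`, and then arm `k` is the one pulled. Hence pulling an arm of index at most `τ` is
at most `1 / q` times as likely as pulling arm `k`. As perturbations are at least `-1`, the former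
moreover requires that the lower confidence bound of arm `k` is at most `τ`. -/
theorem measureReal_pull_low_le [IsProbabilityMeasure P] [IsProbabilityMeasure ν]
    (hrun : IsFTPLRun P D ν ε T g Z A) (hν : ∀ᵐ z ∂ν, z ∈ Set.Icc (-1 : ℝ) 1) {c : ℝ}
    (hc : 0 < ν.real (Set.Ici c)) {t : ℕ} (ht : t < T) (i k : Fin K) (τ : ℝ) :
    P.real {ω | A t ω = i ∧ ftplIndex ε T g Z A i t ω ≤ τ ∧
        τ < sampleMean g A k t ω + width ε T A k t ω * c} ≤
      (ν.real (Set.Ici c))⁻¹ * P.real ({ω | A t ω = k} ∩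
        {ω | sampleMean g A k t ω - width ε T A k t ω ≤ τ}) := by
  have hpast := fun {s} (hs : s < t) => measurable_comap_past g Z A hs
  set X : Ω → Fin K → ℝ × ℝ := fun ω j => (sampleMean g A j t ω, width ε T A j t ω) with hX
  have hXF : Measurable[MeasurableSpace.comap (past g Z A t) inferInstance] X :=
    @measurable_sampleMean_width K Ω (MeasurableSpace.comap (past g Z A t) inferInstance) g A t
      (fun s hs => (hpast hs).1) (fun s hs => (hpast hs).2) ε T
  have hXm : Measurable X := hXF.mono (hrun.measurable_past ht.le).comap_le le_rfl
  have hind : IndepFun (Z t) X P :=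
    indep_of_indep_of_le_right (hrun.perturbation_indep t ht) hXF.comap_le
  set H : Set (Fin K → ℝ × ℝ) := {x | τ < (x k).1 + (x k).2 * c ∧ (x k).1 - (x k).2 ≤ τ} with hH
  have hHm : MeasurableSet H := by
    have h1 : MeasurableSet {x : Fin K → ℝ × ℝ | τ < (x k).1 + (x k).2 * c} :=
      measurableSet_lt (by fun_prop) (by fun_prop)
    have h2 : MeasurableSet {x : Fin K → ℝ × ℝ | (x k).1 - (x k).2 ≤ τ} :=
      measurableSet_le (by fun_prop) (by fun_prop)
    exact h1.inter h2
  have hCm : ∀ j, MeasurableSet {p : (Fin K → ℝ × ℝ) × (Fin K → ℝ) |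
      (p.1 j).1 + (p.1 j).2 * p.2 j ≤ τ} := fun j =>
    measurableSet_le (by fun_prop) (by fun_prop)
  have hbox := measure_box_inter hXm (hrun.measurable_perturbation t ht)
    (hrun.perturbation_law t ht) hind k hHm
    (C := fun x j => {z | (x j).1 + (x j).2 * z ≤ τ})
    hCm (measurableSet_Ici (a := c))
  have h1 : P {ω | A t ω = i ∧ ftplIndex ε T g Z A i t ω ≤ τ ∧
        τ < sampleMean g A k t ω + width ε T A k t ω * c} ≤
      P {ω | X ω ∈ H ∧ ∀ j, j ≠ k → Z t ω j ∈ {z | (X ω j).1 + (X ω j).2 * z ≤ τ}} := by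
    refine measure_mono_ae ?_
    filter_upwards [hrun.action_argmax t ht, hrun.ae_perturbation_mem hν ht] with ω hmax hZ hω
    obtain ⟨h1, h2, h3⟩ := hω
    rw [h1] at hmax
    refine ⟨⟨h3, ?_⟩, fun j _ => (hmax j).trans h2⟩
    have h4 : sampleMean g A k t ω + width ε T A k t ω * Z t ω k ≤ τ := (hmax k).trans h2
    have h5 := mul_le_mul_of_nonneg_left (hZ k).1 (width_nonneg ε T A k t ω)
    change sampleMean g A k t ω - width ε T A k t ω ≤ τ
    linarith
  have h2 : P {ω | X ω ∈ H ∧ (∀ j, j ≠ k → Z t ω j ∈ {z | (X ω j).1 + (X ω j).2 * z ≤ τ}) ∧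
        Z t ω k ∈ Set.Ici c} ≤
      P ({ω | A t ω = k} ∩ {ω | sampleMean g A k t ω - width ε T A k t ω ≤ τ}) := by
    refine measure_mono_ae ?_
    filter_upwards [hrun.action_argmax t ht] with ω hmax hω
    obtain ⟨⟨h1, h2⟩, h3, h4⟩ := hω
    refine ⟨?_, h2⟩
    by_contra hk
    have h5 : ftplIndex ε T g Z A (A t ω) t ω ≤ τ := h3 _ hk
    have h6 : sampleMean g A k t ω + width ε T A k t ω * Z t ω k ≤ τ := (hmax k).trans h5
    have h7 : τ < sampleMean g A k t ω + width ε T A k t ω * c := h1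
    have h8 := mul_le_mul_of_nonneg_left (Set.mem_Ici.1 h4) (width_nonneg ε T A k t ω)
    linarith
  rw [hbox] at h2
  have h1' := ENNReal.toReal_mono (measure_ne_top _ _) h1
  have h2' := ENNReal.toReal_mono (measure_ne_top _ _) h2
  rw [ENNReal.toReal_mul] at h2'
  rw [inv_mul_eq_div, le_div_iff₀ hc, mul_comm]
  exact (mul_le_mul_of_nonneg_left h1' hc.le).trans h2'

/-- A pull of arm `i` happens because its upper confidence bound exceeds `τ`, because the
optimistic index of arm `k` fails to exceed `τ`, or against the odds of `measureReal_pull_low_le`. -/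
theorem measureReal_pull_le [IsProbabilityMeasure P] [IsProbabilityMeasure ν]
    (hrun : IsFTPLRun P D ν ε T g Z A) (hν : ∀ᵐ z ∂ν, z ∈ Set.Icc (-1 : ℝ) 1) {c : ℝ}
    (hc : 0 < ν.real (Set.Ici c)) {t : ℕ} (ht : t < T) (i k : Fin K) (τ : ℝ) :
    P.real {ω | A t ω = i} ≤
      P.real ({ω | A t ω = i} ∩ {ω | τ < sampleMean g A i t ω + width ε T A i t ω}) +
      P.real {ω | sampleMean g A k t ω + width ε T A k t ω * c ≤ τ} +
      (ν.real (Set.Ici c))⁻¹ * P.real ({ω | A t ω = k} ∩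
        {ω | sampleMean g A k t ω - width ε T A k t ω ≤ τ}) := by
  refine le_trans ?_ (add_le_add_right (measureReal_pull_low_le hrun hν hc ht i k τ) _)
  refine le_trans ?_ (add_le_add_left (measureReal_union_le _ _) _)
  refine le_trans ?_ (measureReal_union_le _ _)
  refine ENNReal.toReal_mono (measure_ne_top _ _) (measure_mono_ae ?_)
  filter_upwards [hrun.ae_perturbation_mem hν ht] with ω hZ hω
  by_cases h1 : τ < sampleMean g A i t ω + width ε T A i t ω
  · exact Or.inl (Or.inl ⟨hω, h1⟩)
  by_cases h2 : sampleMean g A k t ω + width ε T A k t ω * c ≤ τ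
  · exact Or.inl (Or.inr h2)
  refine Or.inr ⟨hω, ?_, not_le.1 h2⟩
  rw [ftplIndex_eq]
  have := mul_le_mul_of_nonneg_left (hZ i).2 (width_nonneg ε T A i t ω)
  linarith [not_lt.1 h1]

end Round

/-! ### The expected number of pulls of a suboptimal arm -/

section Pulls

variable {K : ℕ} {Ω : Type*} [MeasurableSpace Ω] {P : Measure Ω} {D : Fin K → Measure ℝ}
  {ν : Measure ℝ} {ε : ℝ} {T : ℕ} {g Z : ℕ → Ω → Fin K → ℝ} {A : ℕ → Ω → Fin K}

theorem one_le_two_mul_log (hT : 2 ≤ T) : 1 ≤ 2 * Real.log T := by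
  have h1 : Real.log 2 ≤ Real.log T := Real.log_le_log (by norm_num) (by exact_mod_cast hT)
  linarith [Real.log_two_gt_d9]

/-- The upper confidence bound `μ̂ + √(2 log T / max 1 T_k)` of arm `k` rarely stays `δ` below the
mean of the arm. The margin `δ` is what makes the union bound over the number of pulls converge:
the deviation `δ + √(2 log T / m)` after `m` pulls has probability at most
`exp (-m δ² / 2) / T`. -/
theorem measureReal_ucb_le [IsProbabilityMeasure P] (hrun : IsFTPLRun P D ν ε T g Z A)
    (hε : 0 < ε) {k : Fin K} (hsub : HasSubgaussianMGF (fun x => x - armMean D k) 1 (D k))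
    (hmean : armMean D k ≤ 1) (hT : 2 ≤ T) {δ : ℝ} (hδ : 0 < δ) {t : ℕ} (ht : t < T) :
    P.real {ω | sampleMean g A k t ω + width ε T A k t ω * √(2 / (2 + ε)) ≤ armMean D k - δ} ≤
      (1 + 2 / δ ^ 2) / T := by
  have hlog := one_le_two_mul_log hT
  have hTpos : (0 : ℝ) < T := by positivity
  have hwidth : ∀ ω, width ε T A k t ω * √(2 / (2 + ε)) =
      √(2 * Real.log T / max 1 (pulls A k t ω : ℝ)) := fun ω => by
    rw [width, ← Real.sqrt_mul (by positivity)]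
    congr 1
    field_simp
  set θ : ℕ → ℝ := fun m => -(δ + √(2 * Real.log T / m)) with hθ
  have hcover : {ω | sampleMean g A k t ω + width ε T A k t ω * √(2 / (2 + ε)) ≤
        armMean D k - δ} ⊆ ⋃ m ∈ (Finset.range T).filter (0 < ·),
      {ω | ∃ t < T, pulls A k t ω = m ∧
        θ m ^ 2 ≤ θ m * (sampleMean g A k t ω - armMean D k)} := by
    intro ω hω
    have hω' : sampleMean g A k t ω + √(2 * Real.log T / max 1 (pulls A k t ω : ℝ)) ≤
      armMean D k - δ := by rw [← hwidth]; exact hω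
    -- Before the first pull the sample mean is `0`, and the bound exceeds `1`.
    have hpos : 0 < pulls A k t ω := by
      by_contra h0
      have h0 : pulls A k t ω = 0 := by omega
      rw [sampleMean, h0] at hω'
      have h1 : (1 : ℝ) ≤ √(2 * Real.log T) := Real.one_le_sqrt.2 hlog
      rw [Nat.cast_zero, div_zero, max_eq_left zero_le_one, div_one] at hω'
      linarith
    have hmax : max 1 (pulls A k t ω : ℝ) = pulls A k t ω :=
      max_eq_right (by exact_mod_cast hpos)
    rw [hmax] at hω'
    simp only [Set.mem_iUnion]
    refine ⟨pulls A k t ω, ?_, t, ht, rfl, ?_⟩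
    · exact Finset.mem_filter.2
        ⟨Finset.mem_range.2 ((pulls_le A k t ω).trans_lt ht), hpos⟩
    · have hneg : 0 ≤ δ + √(2 * Real.log T / (pulls A k t ω : ℝ)) := by positivity
      simp only [hθ]
      nlinarith
  calc _ ≤ ∑ m ∈ (Finset.range T).filter (0 < ·), P.real {ω | ∃ t < T, pulls A k t ω = m ∧
        θ m ^ 2 ≤ θ m * (sampleMean g A k t ω - armMean D k)} :=
        (measureReal_mono hcover (measure_ne_top _ _)).trans (measureReal_biUnion_finset_le _ _)
    _ ≤ ∑ m ∈ (Finset.range T).filter (0 < ·), Real.exp (-(m * (δ ^ 2 / 2))) * (1 / T) := by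
        refine Finset.sum_le_sum fun m hm => ?_
        have hm : (0 : ℝ) < m := by exact_mod_cast (Finset.mem_filter.1 hm).2
        refine (measureReal_deviation_le hrun hsub (θ m) m).trans ?_
        have h1 : (1 : ℝ) / T = Real.exp (-Real.log T) := by
          rw [Real.exp_neg, Real.exp_log hTpos, one_div]
        rw [h1, ← Real.exp_add]
        refine Real.exp_le_exp.2 ?_
        have h2 : √(2 * Real.log T / m) ^ 2 = 2 * Real.log T / m :=
          Real.sq_sqrt (by positivity)
        have h3 : δ ^ 2 + 2 * Real.log T / m ≤ θ m ^ 2 := by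
          simp only [hθ]
          nlinarith [Real.sqrt_nonneg (2 * Real.log T / m)]
        have h4 : m * (2 * Real.log T / m) = 2 * Real.log T := by field_simp
        nlinarith [mul_le_mul_of_nonneg_left h3 hm.le]
    _ ≤ ∑ m ∈ Finset.range T, Real.exp (-(m * (δ ^ 2 / 2))) * (1 / T) :=
        Finset.sum_le_sum_of_subset_of_nonneg (Finset.filter_subset _ _)
          fun _ _ _ => by positivity
    _ ≤ (1 + 1 / (δ ^ 2 / 2)) * (1 / T) := by
        rw [← Finset.sum_mul]
        gcongr
        exact sum_exp_neg_mul_le (by positivity) T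
    _ = (1 + 2 / δ ^ 2) / T := by rw [one_div_div]; ring

/-- The number of pulls of arm `i` is compared with a threshold halfway between the mean of arm `i`
and the largest mean, which is attained at arm `k`. -/
theorem sum_measureReal_pull_le [IsProbabilityMeasure P] [IsProbabilityMeasure ν]
    (hrun : IsFTPLRun P D ν ε T g Z A) (hν : ∀ᵐ z ∂ν, z ∈ Set.Icc (-1 : ℝ) 1) (hε : 0 < ε)
    (hc : 0 < ν.real (Set.Ici √(2 / (2 + ε))))
    (hsub : ∀ i, HasSubgaussianMGF (fun x => x - armMean D i) 1 (D i)) {i k : Fin K}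
    (hk : armMean D k = bestMean D) (hk1 : armMean D k ≤ 1) (hi : 0 < gap D i) (hi1 : gap D i ≤ 1)
    (hT : 2 ≤ T) :
    ∑ t ∈ Finset.range T, P.real {ω | A t ω = i} ≤
      ((1 + (ν.real (Set.Ici √(2 / (2 + ε))))⁻¹) * (16 * (2 + ε) + 68) + 18) *
        (Real.log T / gap D i ^ 2) := by
  set Δ := gap D i with hΔ
  set q := ν.real (Set.Ici √(2 / (2 + ε))) with hq
  set c := √(2 / (2 + ε)) with hc'
  set τ := armMean D k - Δ / 2 with hτ
  have hgap : Δ = armMean D k - armMean D i := by rw [hk]; rfl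
  have hlog := one_le_two_mul_log hT
  have hTpos : (0 : ℝ) < T := by positivity
  set r := (2 + ε) * Real.log T / (Δ / 4) ^ 2 with hr
  have hr0 : 0 ≤ r := by positivity
  have h1 : ∑ t ∈ Finset.range T, P.real ({ω | A t ω = i} ∩
      {ω | τ < sampleMean g A i t ω + width ε T A i t ω}) ≤ r + 2 + 2 / (Δ / 4) ^ 2 := by
    refine le_trans (Finset.sum_le_sum fun t _ => measureReal_mono ?_ (measure_ne_top _ _))
      (sum_pull_deviation_le hrun (hsub i) (θ := Δ / 4) (by positivity) hr0)
    refine Set.inter_subset_inter_right _ fun ω (hω : τ < _) => ?_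
    by_cases h : (pulls A i t ω : ℝ) < r
    · exact Or.inl h
    · refine Or.inr ?_
      have := width_le (by positivity) (not_lt.1 h)
      change (Δ / 4) ^ 2 ≤ Δ / 4 * (sampleMean g A i t ω - armMean D i)
      nlinarith
  have h3 : ∑ t ∈ Finset.range T, P.real ({ω | A t ω = k} ∩
      {ω | sampleMean g A k t ω - width ε T A k t ω ≤ τ}) ≤ r + 2 + 2 / (Δ / 4) ^ 2 := by
    have h := sum_pull_deviation_le hrun (hsub k) (θ := -(Δ / 4))
      (neg_ne_zero.2 (by positivity)) hr0
    rw [neg_sq] at h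
    refine le_trans (Finset.sum_le_sum fun t _ => measureReal_mono ?_ (measure_ne_top _ _)) h
    refine Set.inter_subset_inter_right _ fun ω (hω : _ ≤ τ) => ?_
    by_cases h : (pulls A k t ω : ℝ) < r
    · exact Or.inl h
    · refine Or.inr ?_
      have := width_le (by positivity) (not_lt.1 h)
      nlinarith
  have h2 : ∑ t ∈ Finset.range T, P.real {ω | sampleMean g A k t ω + width ε T A k t ω * c ≤ τ} ≤
      1 + 2 / (Δ / 2) ^ 2 := by
    refine (Finset.sum_le_sum fun t ht => measureReal_ucb_le hrun hε (hsub k) hk1 hT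
      (by positivity) (Finset.mem_range.1 ht)).trans_eq ?_
    rw [Finset.sum_const, Finset.card_range, nsmul_eq_mul, mul_div_cancel₀ _ hTpos.ne']
  have hΔ2 : 1 ≤ 1 / Δ ^ 2 := by
    rw [le_div_iff₀ (by positivity)]
    nlinarith
  set x := Real.log T / Δ ^ 2 with hx
  have hinv : 1 / Δ ^ 2 ≤ 2 * x := by
    rw [hx, ← mul_div_assoc]
    gcongr
  have hr' : r = 16 * (2 + ε) * x := by rw [hr, hx]; field_simp; norm_num
  have e1 : 2 / (Δ / 4) ^ 2 = 32 * (1 / Δ ^ 2) := by field_simp; norm_num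
  have e2 : 2 / (Δ / 2) ^ 2 = 8 * (1 / Δ ^ 2) := by field_simp; norm_num
  have hR : r + 2 + 2 / (Δ / 4) ^ 2 ≤ (16 * (2 + ε) + 68) * x := by
    rw [hr', e1]; linarith
  calc _ ≤ _ := Finset.sum_le_sum fun t ht =>
        measureReal_pull_le hrun hν hc (Finset.mem_range.1 ht) i k τ
    _ ≤ (16 * (2 + ε) + 68) * x + 18 * x + q⁻¹ * ((16 * (2 + ε) + 68) * x) := by
        rw [Finset.sum_add_distrib, Finset.sum_add_distrib, ← Finset.mul_sum]
        refine add_le_add (add_le_add (h1.trans hR) (h2.trans ?_)) ?_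
        · rw [e2]; linarith
        · exact mul_le_mul_of_nonneg_left (h3.trans hR) (inv_nonneg.2 hc.le)
    _ = _ := by ring

end Pulls

/-! ### Regret -/

section Regret

variable {K : ℕ} {Ω : Type*} [MeasurableSpace Ω] {P : Measure Ω} {D : Fin K → Measure ℝ}
  {ν : Measure ℝ} {ε : ℝ} {T : ℕ} {g Z : ℕ → Ω → Fin K → ℝ} {A : ℕ → Ω → Fin K}

theorem armMean_le_bestMean (D : Fin K → Measure ℝ) (i : Fin K) : armMean D i ≤ bestMean D :=
  le_ciSup (Set.finite_range (armMean D)).bddAbove i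

theorem gap_nonneg (D : Fin K → Measure ℝ) (i : Fin K) : 0 ≤ gap D i :=
  sub_nonneg.2 (armMean_le_bestMean D i)

theorem exists_armMean_eq_bestMean (hK : 0 < K) (D : Fin K → Measure ℝ) :
    ∃ k, armMean D k = bestMean D := by
  have : Nonempty (Fin K) := ⟨⟨0, hK⟩⟩
  exact exists_eq_ciSup_of_finite

theorem sum_measureReal_action [IsProbabilityMeasure P] {B : Ω → Fin K} (hB : Measurable B) :
    ∑ i, P.real {ω | B ω = i} = 1 := by
  have h := measureReal_biUnion_finset (μ := P) (s := Finset.univ) (f := fun i => {ω | B ω = i})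
    (fun i _ j _ hij => Set.disjoint_left.2 fun ω (h1 : B ω = i) (h2 : B ω = j) =>
      hij (h1.symm.trans h2)) (fun i _ => hB (measurableSet_singleton i))
  rw [← h]
  have : (⋃ i ∈ Finset.univ, {ω | B ω = i}) = Set.univ := by ext ω; simp
  rw [this, probReal_univ]

theorem integral_reward_eq [IsProbabilityMeasure P] (hrun : IsFTPLRun P D ν ε T g Z A)
    (hD : ∀ i, IsProbabilityMeasure (D i))
    (hsub : ∀ i, HasSubgaussianMGF (fun x => x - armMean D i) 1 (D i)) {t : ℕ} (ht : t < T) :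
    Integrable (fun ω => g t ω (A t ω)) P ∧
      ∫ ω, g t ω (A t ω) ∂P = ∑ i, P.real {ω | A t ω = i} * armMean D i := by
  have hA := hrun.measurable_action t ht
  have hg : ∀ i, Measurable fun ω => g t ω i := fun i =>
    (measurable_pi_apply i).comp (hrun.measurable_reward t ht)
  have hint : ∀ i, Integrable (fun ω => g t ω i) P := fun i => by
    have h1 : Integrable (fun x : ℝ => x) (D i) := by
      have h2 : Integrable (fun x : ℝ => x - armMean D i) (D i) :=
        memLp_one_iff_integrable.1 (by simpa using (hsub i).memLp 1)
      exact (h2.add (integrable_const (armMean D i))).congr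
        (Filter.Eventually.of_forall fun x => by simp)
    rw [← hrun.reward_law t ht i] at h1
    exact h1.comp_measurable (hg i)
  have hmean : ∀ i, ∫ ω, g t ω i ∂P = armMean D i := fun i => by
    rw [armMean, ← hrun.reward_law t ht i, integral_map (hg i).aemeasurable (by fun_prop)]
  have hsum : (fun ω => g t ω (A t ω)) =
      fun ω => ∑ i, (if A t ω = i then (1 : ℝ) else 0) * g t ω i := by
    funext ω; simp
  have hSm : ∀ i, Measurable fun ω => if A t ω = i then (1 : ℝ) else 0 := fun i =>
    Measurable.ite (hA (measurableSet_singleton i)) measurable_const measurable_const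
  have hprod : ∀ i, Integrable (fun ω => (if A t ω = i then (1 : ℝ) else 0) * g t ω i) P :=
    fun i => (hint i).bdd_mul (hSm i).aestronglyMeasurable (c := 1)
      (Filter.Eventually.of_forall fun ω => by split_ifs <;> simp)
  rw [hsum]
  refine ⟨integrable_finsetSum _ fun i _ => hprod i, ?_⟩
  rw [integral_finsetSum _ fun i _ => hprod i]
  refine Finset.sum_congr rfl fun i _ => ?_
  have hind : IndepFun (fun ω => if A t ω = i then (1 : ℝ) else 0) (fun ω => g t ω i) P := by
    have h := hrun.reward_indep t ht
    have hφ : Measurable fun p : (Fin t → (Fin K → ℝ) × (Fin K → ℝ) × Fin K) × (Fin K → ℝ) × Fin K =>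
        if p.2.2 = i then (1 : ℝ) else 0 :=
      Measurable.ite ((measurable_snd.comp measurable_snd) (measurableSet_singleton i))
        measurable_const measurable_const
    exact (h.comp (measurable_pi_apply i) hφ).symm
  rw [hind.integral_fun_mul_eq_mul_integral (hSm i).aestronglyMeasurable
    (hg i).aestronglyMeasurable, hmean]
  congr 1
  have h : (fun ω => if A t ω = i then (1 : ℝ) else 0) = {ω | A t ω = i}.indicator 1 := by
    funext ω; simp [Set.indicator_apply]
  rw [h]
  exact integral_indicator_one (hA (measurableSet_singleton i))

/-- The regret is the sum over the arms of the gap times the expected number of pulls. -/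
theorem regret_eq [IsProbabilityMeasure P] (hrun : IsFTPLRun P D ν ε T g Z A)
    (hD : ∀ i, IsProbabilityMeasure (D i))
    (hsub : ∀ i, HasSubgaussianMGF (fun x => x - armMean D i) 1 (D i)) :
    regret P D T g A = ∑ i, gap D i * ∑ t ∈ Finset.range T, P.real {ω | A t ω = i} := by
  have h1 : ∀ t ∈ Finset.range T, bestMean D - ∫ ω, g t ω (A t ω) ∂P =
      ∑ i, gap D i * P.real {ω | A t ω = i} := fun t ht => by
    have ht := Finset.mem_range.1 ht
    rw [(integral_reward_eq hrun hD hsub ht).2, ← mul_one (bestMean D),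
      ← sum_measureReal_action (P := P) (hrun.measurable_action t ht), Finset.mul_sum,
      ← Finset.sum_sub_distrib]
    exact Finset.sum_congr rfl fun i _ => by rw [gap]; ring
  rw [regret, integral_finsetSum _ fun t ht =>
    (integral_reward_eq hrun hD hsub (Finset.mem_range.1 ht)).1]
  calc (T : ℝ) * bestMean D - ∑ t ∈ Finset.range T, ∫ ω, g t ω (A t ω) ∂P
      = ∑ t ∈ Finset.range T, (bestMean D - ∫ ω, g t ω (A t ω) ∂P) := by simp
    _ = ∑ t ∈ Finset.range T, ∑ i, gap D i * P.real {ω | A t ω = i} := Finset.sum_congr rfl h1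
    _ = _ := by rw [Finset.sum_comm]; simp_rw [Finset.mul_sum]

theorem sum_sum_measureReal_action [IsProbabilityMeasure P]
    (hrun : IsFTPLRun P D ν ε T g Z A) :
    ∑ i, ∑ t ∈ Finset.range T, P.real {ω | A t ω = i} = T := by
  rw [Finset.sum_comm, Finset.sum_congr rfl fun t ht =>
    sum_measureReal_action (P := P) (hrun.measurable_action t (Finset.mem_range.1 ht))]
  simp

end Regret

/-- Numbers of pulls `n i` of at most `C x / Δ i ^ 2` each and `T` in total cost at most
`√(C K T x)`: every term `Δ i * n i` is at most `√(C x * n i)`, and the Cauchy-Schwarz inequality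
sums these terms. -/
theorem sum_mul_le_sqrt {K : ℕ} {Δ n : Fin K → ℝ} {C T x : ℝ} (hΔ : ∀ i, 0 ≤ Δ i)
    (hn : ∀ i, 0 ≤ n i) (hT : ∑ i, n i = T) (hC : 0 ≤ C) (hx : 0 ≤ x)
    (h : ∀ i, 0 < Δ i → n i ≤ C * (x / Δ i ^ 2)) :
    ∑ i, Δ i * n i ≤ √C * √(K * T * x) := by
  have hT0 : 0 ≤ T := hT ▸ Finset.sum_nonneg fun i _ => hn i
  rw [← Real.sqrt_mul hC]
  refine Real.le_sqrt_of_sq_le ?_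
  have hterm : ∀ i, (Δ i * n i) ^ 2 ≤ C * x * n i := fun i => by
    rcases (hΔ i).eq_or_lt with h0 | h0
    · rw [← h0, zero_mul, zero_pow two_ne_zero]
      exact mul_nonneg (mul_nonneg hC hx) (hn i)
    · have h1 : n i * Δ i ^ 2 ≤ C * x := by
        have := h i h0
        rwa [← mul_div_assoc, le_div_iff₀ (by positivity)] at this
      nlinarith [mul_le_mul_of_nonneg_right h1 (hn i)]
  calc (∑ i, Δ i * n i) ^ 2
      ≤ (Finset.univ : Finset (Fin K)).card * ∑ i, (Δ i * n i) ^ 2 := sq_sum_le_card_mul_sum_sq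
    _ ≤ K * ∑ i, C * x * n i := by
        rw [Finset.card_fin]
        gcongr with i
        exact hterm i
    _ = C * (K * T * x) := by rw [← Finset.mul_sum, hT]; ring

/-- The regret bounds need only a perturbation bounded by `1` in absolute value that exceeds
`√(2 / (2 + ε))` with positive probability. -/
theorem hasFTPLRegretBounds {ν : Measure ℝ} [IsProbabilityMeasure ν]
    (hν : ∀ᵐ z ∂ν, z ∈ Set.Icc (-1 : ℝ) 1) {ε : ℝ} (hε : 0 < ε)
    (hc : ν (Set.Ici √(2 / (2 + ε))) ≠ 0) : HasFTPLRegretBounds.{u} ν ε := by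
  have hq : 0 < ν.real (Set.Ici √(2 / (2 + ε))) := ENNReal.toReal_pos hc (measure_ne_top _ _)
  set C := (1 + (ν.real (Set.Ici √(2 / (2 + ε))))⁻¹) * (16 * (2 + ε) + 68) + 18 with hC
  have hC1 : 1 ≤ C := by
    have h1 : 0 ≤ (1 + (ν.real (Set.Ici √(2 / (2 + ε))))⁻¹) * (16 * (2 + ε) + 68) := by positivity
    linarith
  have hC0 : 0 ≤ C := by linarith
  refine ⟨C, by linarith, ?_⟩
  intro K hK D hD hsub hmean T Ω _ P hP g Z A hrun
  obtain ⟨k, hk⟩ := exists_armMean_eq_bestMean hK D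
  set n : Fin K → ℝ := fun i => ∑ t ∈ Finset.range T, P.real {ω | A t ω = i} with hn
  have hn0 : ∀ i, 0 ≤ n i := fun i => Finset.sum_nonneg fun _ _ => measureReal_nonneg
  have hbound : 2 ≤ T → ∀ i, 0 < gap D i → n i ≤ C * (Real.log T / gap D i ^ 2) := by
    intro hT i hi
    refine sum_measureReal_pull_le hrun hν hε hq hsub hk (hmean k).2 hi ?_ hT
    rw [gap, ← hk]
    linarith [(hmean k).2, (hmean i).1]
  rw [regret_eq hrun hD hsub]
  have hlog : 0 ≤ Real.log T := Real.log_natCast_nonneg T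
  refine ⟨?_, fun hT => ?_⟩
  · rw [Finset.mul_sum, Finset.sum_filter]
    refine Finset.sum_le_sum fun i _ => ?_
    split_ifs with hi
    · -- For `T ≤ 1` the logarithm vanishes, and the summand `gap D i` covers the only pull.
      rcases le_or_gt 2 T with hT | hT
      · calc gap D i * n i ≤ gap D i * (C * (Real.log T / gap D i ^ 2)) := by
              gcongr; exact hbound hT i hi
          _ = C * (Real.log T / gap D i) := by field_simp
          _ ≤ C * (Real.log T / gap D i + gap D i) := by gcongr; linarith
      · have h1 : n i ≤ 1 := by
          calc n i ≤ ∑ t ∈ Finset.range T, 1 := Finset.sum_le_sum fun _ _ => measureReal_le_one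
            _ ≤ 1 := by
              rw [Finset.sum_const, Finset.card_range, nsmul_eq_mul, mul_one]
              exact_mod_cast Nat.lt_succ_iff.1 hT
        have h2 : 0 ≤ Real.log T / gap D i := by positivity
        calc gap D i * n i ≤ 1 * (gap D i) := by nlinarith
          _ ≤ C * (Real.log T / gap D i + gap D i) := by
              gcongr; linarith
    · have h0 : gap D i = 0 := le_antisymm (not_lt.1 hi) (gap_nonneg D i)
      rw [h0, zero_mul]
  · refine (sum_mul_le_sqrt (gap_nonneg D) hn0 (sum_sum_measureReal_action hrun) hC0 hlog
      (hbound hT)).trans ?_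
    gcongr
    exact Real.sqrt_le_iff.2 ⟨hC0, by nlinarith⟩

/-! ### The uniform and the Rademacher perturbation -/

theorem sqrt_two_div_lt_one {ε : ℝ} (hε : 0 < ε) : √(2 / (2 + ε)) < 1 := by
  rw [Real.sqrt_lt' one_pos, one_pow, div_lt_one (by linarith)]
  linarith

theorem hasFTPLRegretBounds_uniformLaw {ε : ℝ} (hε : 0 < ε) :
    HasFTPLRegretBounds.{u} uniformLaw ε := by
  have hprob : IsProbabilityMeasure uniformLaw :=
    cond_isProbabilityMeasure_of_finite (by simp [Real.volume_Icc]) (by simp)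
  refine hasFTPLRegretBounds (ν := uniformLaw) (ae_cond_mem measurableSet_Icc) hε ?_
  have hsubset : Set.Icc √(2 / (2 + ε)) 1 ⊆ Set.Icc (-1 : ℝ) 1 ∩ Set.Ici √(2 / (2 + ε)) :=
    fun z hz => ⟨⟨by linarith [hz.1, Real.sqrt_nonneg (2 / (2 + ε))], hz.2⟩, hz.1⟩
  have hpos : volume (Set.Icc (-1 : ℝ) 1 ∩ Set.Ici √(2 / (2 + ε))) ≠ 0 := fun h0 => by
    have h := measure_mono_null hsubset h0
    rw [Real.volume_Icc, ENNReal.ofReal_eq_zero] at h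
    linarith [sqrt_two_div_lt_one hε]
  rw [uniformLaw, cond_apply measurableSet_Icc]
  exact mul_ne_zero (by simp) hpos

theorem hasFTPLRegretBounds_rademacherLaw {ε : ℝ} (hε : 0 < ε) :
    HasFTPLRegretBounds.{u} rademacherLaw ε := by
  have hprob : IsProbabilityMeasure rademacherLaw := ⟨by
    simp [rademacherLaw, ENNReal.inv_two_add_inv_two]⟩
  refine hasFTPLRegretBounds ?_ hε ?_
  · rw [ae_iff, rademacherLaw, ← Set.compl_def, Measure.add_apply]
    simp
  · have h : (1 : ℝ) ∈ Set.Ici √(2 / (2 + ε)) := (sqrt_two_div_lt_one hε).le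
    rw [rademacherLaw, Measure.add_apply, Measure.smul_apply, Measure.smul_apply,
      Measure.dirac_apply_of_mem h]
    simp

end Bandit

theorem theorem3 :
    (∀ (ν : Measure ℝ), IsProbabilityMeasure ν →
      (∀ᵐ z ∂ν, z ∈ Set.Icc (-1 : ℝ) 1) → ∫ z, z ∂ν = 0 →
      ∀ ε : ℝ, 0 < ε →
      (∃ M : ℝ≥0∞, 0 < M ∧ M < ∞ ∧
        ν (Set.Iic √(2 / (2 + ε))) / ν (Set.Ici √(2 / (2 + ε))) = M) →
      Bandit.HasFTPLRegretBounds.{u} ν ε) ∧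
    (∀ ε : ℝ, 0 < ε → Bandit.HasFTPLRegretBounds.{u} Bandit.uniformLaw ε) ∧
    (∀ ε : ℝ, 0 < ε → Bandit.HasFTPLRegretBounds.{u} Bandit.rademacherLaw ε) := by
  refine ⟨?_, fun ε hε => Bandit.hasFTPLRegretBounds_uniformLaw hε,
    fun ε hε => Bandit.hasFTPLRegretBounds_rademacherLaw hε⟩
  rintro ν hν hbdd - ε hε ⟨M, hM0, hM, h⟩
  refine Bandit.hasFTPLRegretBounds hbdd hε fun h0 => ?_
  -- A ratio with denominator `0` in `ℝ≥0∞` is `0` or `∞`.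
  rw [h0] at h
  rcases eq_or_ne (ν (Set.Iic √(2 / (2 + ε)))) 0 with h1 | h1
  · rw [h1, ENNReal.zero_div] at h
    exact hM0.ne h
  · rw [ENNReal.div_zero h1] at h
    exact hM.ne h.symm
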